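/- Setting. Let $N,k\ge 1$ and $d=k(2^N-1)$, and partition $d\times d$ real matrices into $k\times k$ blocks indexed by $[2^N-1]^2$. For $1\le l\le N$ and $1\le r\le 2^{N-l}$ let $I_{r,l}=\{2^{l-1}(2r-1)\}$, let $I'_{r,l}=\{2^{l-1}(2r-1)+t: |t|\le 2^{l-1}-1\}$, and let level $l$ be $I_l=\bigcup_r I_{r,l}$. A matrix is in $\mathcal{VD}(N)$ if its blocks outside $\bigcup_{l,r} I'_{r,l}\times I_{r,l}$ vanish. It is block-tridiagonal with block size $k$ if its blocks $(i,j)$ with $|i-j|>1$ vanish. For a matrix $\Sigma$ let $\Sigma_{l',l}$ be its submatrix with block rows in level $l'$ and block columns in level $l$. Dyadic algorithm. Start with $P=G_1(\Sigma_{1,1})$. For $l=2,\dots,N$, let $\check\Sigma$ be the matrix $\Sigma_{1,l},\dots,\Sigma_{l-1,l}$ stacked, and compute $\check\Sigma'=P^\top\check\Sigma$, $A=P\check\Sigma'$, $\tilde\Sigma=\Sigma_{l,l}-\check\Sigma'^\top\check\Sigma'$, $G=G_l(\tilde\Sigma)$, and replace $P$ by $\begin{bmatrix}P&-AG\\0&G\end{bmatrix}$.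 Return $P$, its block rows and columns being labelled by their indices in $[2^N-1]$. Here $G_l$ applies Gram–Schmidt orthonormalization to each $k\times k$ diagonal block of its argument (with respect to that block as gramian). Every matrix is stored with its block-sparsity pattern (for $\Sigma$: the block-tridiagonal one), products and differences are evaluated only on the blocks that these patterns allow to be nonzero, and each addition, subtraction, multiplication, division and square root of real numbers counts as one flop. Theorem. There is an absolute constant $C>0$ such that for all $N,k\ge 1$, with $d=k(2^N-1)$, and every symmetric positive definite $d\times d$ matrix $\Sigma$ that is block-tridiagonal with block size $k$, the dyadic algorithm returns a matrix $P\in\mathcal{VD}(N)$ with $P^\top\Sigma P=I$, and it uses at most $C\,dk^2\log(d/k)$ flops if $N\ge 2$, and at most $C\,dk^2$ flops if $N=1$ (where $\log(d/k)=0$). -/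

import Mathlib

namespace Dyadic

/-! ### Counting floating-point operations -/

/-- The result of a computation together with the number of flops that were spent on it. -/
structure Flop (α : Type) where
  val : α
  cost : ℕ

namespace Flop

instance : Monad Flop where
  pure a := ⟨a, 0⟩
  bind x f := ⟨(f x.val).val, x.cost + (f x.val).cost⟩

/-! The arithmetic operations on scalars; each of them costs one flop. -/

noncomputable def mul (x y : ℝ) : Flop ℝ := ⟨x * y, 1⟩

noncomputable def sub (x y : ℝ) : Flop ℝ := ⟨x - y, 1⟩

noncomputable def div (x y : ℝ) : Flop ℝ := ⟨x / y, 1⟩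

noncomputable def sqrt (x : ℝ) : Flop ℝ := ⟨Real.sqrt x, 1⟩

/-- Summation of the terms `f i`, `i ∈ s`, into an accumulator that starts at `0`:
one addition for each term, besides the cost of computing the terms. -/
noncomputable def sum {ι : Type} (s : Finset ι) (f : ι → Flop ℝ) : Flop ℝ :=
  ⟨∑ i ∈ s, (f i).val, ∑ i ∈ s, ((f i).cost + 1)⟩

/-- The loop `for i ∈ s do x i := f i` on an array `x` that is initialized with zeros. -/
def forEach {ι β : Type} [DecidableEq ι] [Zero β] (s : Finset ι) (f : ι → Flop β) :
    Flop (ι → β) :=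
  ⟨fun i => if i ∈ s then (f i).val else 0, ∑ i ∈ s, (f i).cost⟩

/-- The loop `for (i, j) ∈ s do A i j := f i j` on a matrix `A` that is initialized with zeros. -/
def forEntries {ι κ β : Type} [DecidableEq ι] [DecidableEq κ] [Zero β] (s : Finset (ι × κ))
    (f : ι → κ → Flop β) : Flop (Matrix ι κ β) := do
  let A ← forEach s fun p => f p.1 p.2
  return Matrix.of fun i j => A (i, j)

end Flop

/-! ### Gram-Schmidt orthonormalization of `k` vectors with given gramian -/

/-- The `j`-th step of Gram-Schmidt. The columns of `Q` with index `< j` hold the coordinates of the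
vectors `q_i` obtained so far, the inner product of coordinate vectors `x`, `y` being `xᵀ S y`.
The step computes `v = e_j - ∑_{i < j} ⟨q_i, e_j⟩ q_i` and writes `v / ‖v‖` into column `j`. -/
noncomputable def gramSchmidtStep {k : ℕ} (S : Matrix (Fin k) (Fin k) ℝ) (j : Fin k)
    (Q : Matrix (Fin k) (Fin k) ℝ) : Flop (Matrix (Fin k) (Fin k) ℝ) := do
  let c ← Flop.forEach (Finset.Iio j) fun i =>
    Flop.sum Finset.univ fun m => Flop.mul (Q m i) (S m j)
  let v ← Flop.forEach Finset.univ fun m => do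
    let p ← Flop.sum (Finset.Iio j) fun i => Flop.mul (Q m i) (c i)
    Flop.sub (if m = j then 1 else 0) p
  let w ← Flop.forEach Finset.univ fun m =>
    Flop.sum Finset.univ fun m' => Flop.mul (S m m') (v m')
  let t ← Flop.sum Finset.univ fun m => Flop.mul (v m) (w m)
  let s ← Flop.sqrt t
  let q ← Flop.forEach Finset.univ fun m => Flop.div (v m) s
  return Matrix.of fun m i => if i = j then q m else Q m i

/-- The first `j` steps of Gram-Schmidt. -/
noncomputable def gramSchmidtUpTo {k : ℕ} (S : Matrix (Fin k) (Fin k) ℝ) :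
    ℕ → Flop (Matrix (Fin k) (Fin k) ℝ)
  | 0 => return 0
  | j + 1 => do
    let Q ← gramSchmidtUpTo S j
    if h : j < k then gramSchmidtStep S ⟨j, h⟩ Q else return Q

/-- Gram-Schmidt for the gramian `S`: computes `G` with `Gᵀ S G = 1` if `S` is positive definite. -/
noncomputable def gramSchmidt {k : ℕ} (S : Matrix (Fin k) (Fin k) ℝ) :
    Flop (Matrix (Fin k) (Fin k) ℝ) :=
  gramSchmidtUpTo S k

/-! ### Block-sparsity patterns and block-sparse matrices -/

/-- `A`, partitioned into `k × k` blocks `A_{i,j}`, has the block-sparsity pattern `T`: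
`A_{i,j} = 0` whenever `(i, j) ∉ T`. The entry of `A_{i,j}` at `(a, b)` is `A (i, a) (j, b)`. -/
def HasPattern {n k : ℕ} (T : Finset (Fin n × Fin n))
    (A : Matrix (Fin n × Fin k) (Fin n × Fin k) ℝ) : Prop :=
  ∀ i j, (i, j) ∉ T → ∀ a b, A (i, a) (j, b) = 0

/-- A block matrix stored in sparse form: the pattern of the blocks that are stored, and these
blocks. The blocks outside of the pattern are zero, whatever `blk` says about them. -/
structure BlockSparse (n k : ℕ) where
  pat : Finset (Fin n × Fin n)
  blk : Matrix (Fin n) (Fin n) (Matrix (Fin k) (Fin k) ℝ)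

namespace BlockSparse

variable {n k : ℕ}

/-- The block of `A` at `(i, j)`. -/
noncomputable def get (A : BlockSparse n k) (i j : Fin n) : Matrix (Fin k) (Fin k) ℝ :=
  if (i, j) ∈ A.pat then A.blk i j else 0

/-- The matrix that `A` stores. -/
noncomputable def toMatrix (A : BlockSparse n k) :
    Matrix (Fin n × Fin k) (Fin n × Fin k) ℝ :=
  Matrix.of fun p q => A.get p.1 q.1 p.2 q.2

/-- The blocks of the matrix `A` at the positions in `T`, in sparse form. -/
def ofMatrix (T : Finset (Fin n × Fin n)) (A : Matrix (Fin n × Fin k) (Fin n × Fin k) ℝ) :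
    BlockSparse n k :=
  ⟨T, Matrix.of fun i j => Matrix.of fun a b => A (i, a) (j, b)⟩

/-- No block is stored: the zero matrix. -/
def empty : BlockSparse n k := ⟨∅, 0⟩

/-- The submatrix with block rows in `R` and block columns in `C`. All submatrices keep the block
indices of the full matrix, so no index ever has to be translated. -/
def restrict (R C : Finset (Fin n)) (A : BlockSparse n k) : BlockSparse n k :=
  ⟨A.pat ∩ (R ×ˢ C), A.blk⟩

def transpose (A : BlockSparse n k) : BlockSparse n k :=
  ⟨A.pat.image Prod.swap, Matrix.of fun i j => (A.blk j i).transpose⟩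

/-- The matrix assembled from the blocks of `A` and of `B`, whose patterns are disjoint when this
is used. -/
def merge (A B : BlockSparse n k) : BlockSparse n k :=
  ⟨A.pat ∪ B.pat, Matrix.of fun i j => if (i, j) ∈ A.pat then A.blk i j else B.blk i j⟩

/-- The indices `m` for which the blocks of `A` at `(i, m)` and of `B` at `(m, j)` are stored. -/
def inner (A B : BlockSparse n k) (i j : Fin n) : Finset (Fin n) :=
  Finset.univ.filter fun m => (i, m) ∈ A.pat ∧ (m, j) ∈ B.pat

/-- The block-sparse product: the block at `(i, j)` is the sum of the products of stored blocks of
`A` at `(i, m)` and of `B` at `(m, j)`, and it is stored if there are any. -/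
noncomputable def mul (A B : BlockSparse n k) : Flop (BlockSparse n k) := do
  let T : Finset (Fin n × Fin n) := Finset.univ.filter fun p => (inner A B p.1 p.2).Nonempty
  let C ← Flop.forEntries T fun i j => Flop.forEntries Finset.univ fun a b =>
    Flop.sum (inner A B i j ×ˢ Finset.univ) fun mc =>
      Flop.mul (A.blk i mc.1 a mc.2) (B.blk mc.1 j mc.2 b)
  return ⟨T, C⟩

/-- The block-sparse difference: one subtraction for each entry of each stored block of `B`. -/
noncomputable def sub (A B : BlockSparse n k) : Flop (BlockSparse n k) := do
  let T := A.pat ∪ B.pat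
  let C ← Flop.forEntries T fun i j =>
    if (i, j) ∈ B.pat then
      Flop.forEntries Finset.univ fun a b => Flop.sub (A.get i j a b) (B.get i j a b)
    else return A.get i j
  return ⟨T, C⟩

/-- Orthonormalization of a block-diagonal gramian, with diagonal blocks at `L`: Gram-Schmidt is
applied to each of the diagonal blocks. -/
noncomputable def orthDiag (L : Finset (Fin n)) (A : BlockSparse n k) :
    Flop (BlockSparse n k) := do
  let G ← Flop.forEach L fun i => gramSchmidt (A.get i i)
  return ⟨L.image fun i => (i, i), Matrix.of fun i _ => G i⟩

end BlockSparse

/-! ### The dyadic pyramid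

The block indices `1, …, 2 ^ N - 1` are represented by `Fin (2 ^ N - 1)`; the index of
`i : Fin (2 ^ N - 1)` is `i + 1`. -/

/-- The element of `I_{r,l}`. -/
def node (r l : ℕ) : ℕ := 2 ^ (l - 1) * (2 * r - 1)

/-- The set `I'_{r,l}` of the consecutive integers `node r l + t`, `|t| ≤ 2 ^ (l - 1) - 1`. -/
def subtree (r l : ℕ) : Finset ℕ :=
  Finset.Icc (node r l - (2 ^ (l - 1) - 1)) (node r l + (2 ^ (l - 1) - 1))

/-- The level `I_l = ⋃ r, I_{r,l}` of the pyramid of height `N`. -/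
def level (N l : ℕ) : Finset (Fin (2 ^ N - 1)) :=
  Finset.univ.filter fun i => i.val + 1 ∈ (Finset.Icc 1 (2 ^ (N - l))).image fun r => node r l

/-- The union of the levels `1, …, l - 1`. -/
def levelsBelow (N l : ℕ) : Finset (Fin (2 ^ N - 1)) :=
  (Finset.Ico 1 l).biUnion (level N)

/-- The vertically dyadic pattern `VD(N)`: the union of the sets `I'_{r,l} × I_{r,l}`. -/
def verticallyDyadic (N : ℕ) : Finset (Fin (2 ^ N - 1) × Fin (2 ^ N - 1)) :=
  Finset.univ.filter fun p => ∃ l ∈ Finset.Icc 1 N, ∃ r ∈ Finset.Icc 1 (2 ^ (N - l)),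
    p.1.val + 1 ∈ subtree r l ∧ p.2.val + 1 = node r l

/-- The block-tridiagonal pattern. -/
def tridiagonal (n : ℕ) : Finset (Fin n × Fin n) :=
  Finset.univ.filter fun p => p.1.val ≤ p.2.val + 1 ∧ p.2.val ≤ p.1.val + 1

/-! ### The dyadic algorithm -/

/-- The state `P` of the sequential orthogonalization of `S` after the levels `1, …, l`. -/
noncomputable def sequentialOrth (N : ℕ) {k : ℕ} (S : BlockSparse (2 ^ N - 1) k) :
    ℕ → Flop (BlockSparse (2 ^ N - 1) k)
  | 0 => return BlockSparse.empty
  | 1 => BlockSparse.orthDiag (level N 1) (S.restrict (level N 1) (level N 1))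
  | l + 2 => do
    let P ← sequentialOrth N S (l + 1)
    let L := level N (l + 2)
    let S₁ := S.restrict (levelsBelow N (l + 2)) L
    let S₂ ← P.transpose.mul S₁
    let A ← P.mul S₂
    let B ← S₂.transpose.mul S₂
    let S₃ ← (S.restrict L L).sub B
    let G ← BlockSparse.orthDiag L S₃
    let AG ← A.mul G
    let negAG ← BlockSparse.empty.sub AG
    return (P.merge negAG).merge G

/-- The dyadic algorithm, run on the matrix `S` stored with the pattern `T`. -/
noncomputable def dyadicAlgorithm (N : ℕ) {k : ℕ}
    (T : Finset (Fin (2 ^ N - 1) × Fin (2 ^ N - 1)))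
    (S : Matrix (Fin (2 ^ N - 1) × Fin k) (Fin (2 ^ N - 1) × Fin k) ℝ) :
    Flop (BlockSparse (2 ^ N - 1) k) :=
  sequentialOrth N (BlockSparse.ofMatrix T S) N

end Dyadic

/-!
The algorithm is a block Gram-Schmidt process that takes the levels of the pyramid in increasing
order. If the columns of `P` are orthonormal for the form `Σ` and span coordinates in `U`, then
`F - P (Pᵀ Σ F)` are the new coordinate vectors `F`, with indices in the next level `L`, made
orthogonal to them, and their gramian is `Σ̃ = F Σ F - (Pᵀ Σ F)ᵀ (Pᵀ Σ F)` (`residual_gramian`). It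
is positive definite on `L` because the residuals still have the identity as their `L`-part
(`posDef_get_of_toMatrix_eq`). So orthonormalizing for `Σ̃` keeps `Pᵀ Σ P` equal to the projection
onto the levels treated so far (`extended_gramian`, `levelStep_gramian`). As only the diagonal
blocks of `Σ̃` are orthonormalized, it matters that `Σ̃` is block-diagonal.

This and the cost come from the patterns. An index `m` has level `t + 1` if
`m % 2 ^ (t + 1) = 2 ^ t`, and the subtrees `I'` of level `t + 1` are the intervals between
consecutive multiples of `2 ^ (t + 1)`. A column `j` of level `t + 1` in `Σ` meets the smaller levels
only in `j ± 1`, so `Pᵀ Σ` has a block at `(c, j)` only if the subtree of `c` ends next to `j`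
(`Touches`). Such a `c` lies in the subtree of `j`, hence determines `j`, and `Σ̃` is block-diagonal.
The columns of `P (Pᵀ Σ F)` are then supported in the subtree of `j`, which gives the pattern `VD(N)`.

In each product, the pairs of blocks that are multiplied are determined by one index, so that
there are at most `2 ^ N` of them; only in `P (Pᵀ Σ F)` there may be up to `2 * 2 ^ N`, because a
column `j` touches up to two subtrees of each smaller level, and their sizes form a geometric sum
(`card_products_mul_isTouching_le`). With `O(k³)` flops for a product of blocks or a Gram-Schmidt
orthonormalization, each of the `N` levels takes `O(2 ^ N k³)` flops.
-/

namespace Dyadic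

/-! ### Costs and values of compound computations -/

namespace Flop

@[simp] theorem val_pure {α : Type} (a : α) : (pure a : Flop α).val = a := rfl

@[simp] theorem cost_pure {α : Type} (a : α) : (pure a : Flop α).cost = 0 := rfl

@[simp] theorem val_bind {α β : Type} (x : Flop α) (f : α → Flop β) :
    (x >>= f).val = (f x.val).val := rfl

@[simp] theorem cost_bind {α β : Type} (x : Flop α) (f : α → Flop β) :
    (x >>= f).cost = x.cost + (f x.val).cost := rfl

@[simp] theorem val_forEntries {ι κ β : Type} [DecidableEq ι] [DecidableEq κ] [Zero β]
    (s : Finset (ι × κ)) (f : ι → κ → Flop β) (i : ι) (j : κ) :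
    (forEntries s f).val i j = if (i, j) ∈ s then (f i j).val else 0 := rfl

@[simp] theorem cost_forEntries {ι κ β : Type} [DecidableEq ι] [DecidableEq κ] [Zero β]
    (s : Finset (ι × κ)) (f : ι → κ → Flop β) :
    (forEntries s f).cost = ∑ p ∈ s, (f p.1 p.2).cost := rfl

end Flop

/-! ### Gram-Schmidt orthonormalization -/

section GramSchmidt

open Matrix

variable {k : ℕ}

/-- The unnormalized vector `e_j - ∑_{i < j} ⟨q_i, e_j⟩ q_i` of the `j`-th Gram-Schmidt step. -/
noncomputable def gramSchmidtResidual (S : Matrix (Fin k) (Fin k) ℝ) (j : Fin k)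
    (Q : Matrix (Fin k) (Fin k) ℝ) (m : Fin k) : ℝ :=
  (if m = j then 1 else 0) - ∑ i ∈ Finset.Iio j, Q m i * ∑ m', Q m' i * S m' j

theorem gramSchmidtStep_val (S : Matrix (Fin k) (Fin k) ℝ) (j : Fin k)
    (Q : Matrix (Fin k) (Fin k) ℝ) (m i : Fin k) :
    (gramSchmidtStep S j Q).val m i =
      if i = j then gramSchmidtResidual S j Q m /
        Real.sqrt (gramSchmidtResidual S j Q ⬝ᵥ S *ᵥ gramSchmidtResidual S j Q)
      else Q m i := by
  have hv : (fun m => (if m = j then (1 : ℝ) else 0) - ∑ i ∈ Finset.Iio j, Q m i *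
      (if i ∈ Finset.Iio j then ∑ m', Q m' i * S m' j else 0)) = gramSchmidtResidual S j Q := by
    funext m
    unfold gramSchmidtResidual
    congr 1
    refine Finset.sum_congr rfl fun i hi => ?_
    rw [if_pos hi]
  rw [← hv]
  simp [gramSchmidtStep, Flop.forEach, Flop.sum, Flop.mul, Flop.sub, Flop.div, Flop.sqrt,
    dotProduct, mulVec]

theorem gramSchmidtStep_cost_le (S : Matrix (Fin k) (Fin k) ℝ) (j : Fin k)
    (Q : Matrix (Fin k) (Fin k) ℝ) : (gramSchmidtStep S j Q).cost ≤ 11 * k ^ 2 := by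
  have hj : (j : ℕ) ≤ k := j.isLt.le
  have hk : 1 ≤ k := j.pos
  have : (gramSchmidtStep S j Q).cost =
      j * (k * 2) + (k * (j * 2 + 1) + (k * (k * 2) + (k * 2 + (1 + k)))) := by
    simp [gramSchmidtStep, Flop.forEach, Flop.sum, Flop.mul, Flop.sub, Flop.div, Flop.sqrt]
  rw [this]
  nlinarith [Nat.mul_le_mul hj (le_refl k)]

theorem gramSchmidtUpTo_cost_le (S : Matrix (Fin k) (Fin k) ℝ) (j : ℕ) :
    (gramSchmidtUpTo S j).cost ≤ 11 * k ^ 2 * j := by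
  induction j with
  | zero => simp [gramSchmidtUpTo]
  | succ j ih =>
    simp only [gramSchmidtUpTo, Flop.cost_bind]
    split_ifs with h
    · have := gramSchmidtStep_cost_le S ⟨j, h⟩ (gramSchmidtUpTo S j).val
      linarith
    · rw [Flop.cost_pure]
      nlinarith

theorem gramSchmidt_cost_le (S : Matrix (Fin k) (Fin k) ℝ) :
    (gramSchmidt S).cost ≤ 11 * k ^ 3 :=
  (gramSchmidtUpTo_cost_le S k).trans_eq (by ring)

theorem gramSchmidtResidual_eq (S : Matrix (Fin k) (Fin k) ℝ) (j : Fin k)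
    (Q : Matrix (Fin k) (Fin k) ℝ) :
    gramSchmidtResidual S j Q =
      Pi.single j 1 - ∑ i ∈ Finset.Iio j, (Q.col i ⬝ᵥ S.col j) • Q.col i := by
  funext m
  simp only [gramSchmidtResidual, Pi.sub_apply, Pi.single_apply, Finset.sum_apply, Pi.smul_apply,
    smul_eq_mul, dotProduct, col_apply]
  congr 1
  exact Finset.sum_congr rfl fun i _ => _root_.mul_comm (Q m i) _

/-- The state of Gram-Schmidt after `j` steps: the first `j` columns are upper triangular and
orthonormal. Triangularity is what keeps the residual of the next step away from zero. -/
theorem gramSchmidtUpTo_spec {S : Matrix (Fin k) (Fin k) ℝ} (hS : S.PosDef) (j : ℕ)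
    (hj : j ≤ k) :
    (∀ m i : Fin k, i.val < j → i < m → (gramSchmidtUpTo S j).val m i = 0) ∧
    ∀ i i' : Fin k, i.val < j → i'.val < j →
      (gramSchmidtUpTo S j).val.col i ⬝ᵥ S *ᵥ (gramSchmidtUpTo S j).val.col i' =
        if i = i' then 1 else 0 := by
  induction j with
  | zero => simp
  | succ j ih =>
    obtain ⟨htri, horth⟩ := ih (by omega)
    have hjk : j < k := by omega
    set Q := (gramSchmidtUpTo S j).val with hQ
    have hval : (gramSchmidtUpTo S (j + 1)).val = (gramSchmidtStep S ⟨j, hjk⟩ Q).val := by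
      simp [gramSchmidtUpTo, hjk, hQ]
    set J : Fin k := ⟨j, hjk⟩ with hJ
    set v := gramSchmidtResidual S J Q with hv
    have hsymm : ∀ x y : Fin k → ℝ, x ⬝ᵥ S *ᵥ y = y ⬝ᵥ S *ᵥ x := by
      intro x y
      have hT : Sᵀ = S := by simpa using hS.isHermitian.eq
      rw [dotProduct_mulVec, ← mulVec_transpose, hT, dotProduct_comm]
    have hlt : ∀ i : Fin k, i.val < j + 1 → i ≠ J → i.val < j := by
      intro i hi hne
      have : i.val ≠ j := fun h => hne (Fin.ext h)
      omega
    have hvtri : ∀ m, J < m → v m = 0 := by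
      intro m hm
      rw [hv, gramSchmidtResidual, if_neg hm.ne', Finset.sum_eq_zero, sub_zero]
      intro i hi
      have hi' := Finset.mem_Iio.1 hi
      rw [htri m i hi' (hi'.trans hm), zero_mul]
    have hvJ : v J = 1 := by
      rw [hv, gramSchmidtResidual, if_pos rfl, Finset.sum_eq_zero, sub_zero]
      intro i hi
      have hi' := Finset.mem_Iio.1 hi
      rw [htri J i hi' hi', zero_mul]
    have hv0 : v ≠ 0 := fun h => by simp [h] at hvJ
    have hpos : 0 < v ⬝ᵥ S *ᵥ v := by simpa using hS.dotProduct_mulVec_pos hv0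
    have hperp : ∀ i : Fin k, i.val < j → Q.col i ⬝ᵥ S *ᵥ v = 0 := by
      intro i hi
      rw [hv, gramSchmidtResidual_eq, mulVec_sub, dotProduct_sub, mulVec_sum, dotProduct_sum,
        mulVec_single_one, Finset.sum_eq_single i, mulVec_smul, dotProduct_smul,
        horth i i hi hi]
      · simp
      · intro i' hi' hne
        rw [mulVec_smul, dotProduct_smul, horth i i' hi (Fin.lt_def.1 (Finset.mem_Iio.1 hi')),
          if_neg hne.symm, smul_zero]
      · intro h
        exact absurd (Finset.mem_Iio.2 (Fin.lt_def.2 hi)) h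
    have hcolJ : (gramSchmidtUpTo S (j + 1)).val.col J = (Real.sqrt (v ⬝ᵥ S *ᵥ v))⁻¹ • v := by
      funext m
      rw [hval, col_apply, gramSchmidtStep_val, if_pos rfl, div_eq_inv_mul]
      rfl
    have hcol : ∀ i, i ≠ J → (gramSchmidtUpTo S (j + 1)).val.col i = Q.col i := by
      intro i hi
      funext m
      rw [hval, col_apply, gramSchmidtStep_val, if_neg hi]
      rfl
    constructor
    · intro m i hi hm
      by_cases h : i = J
      · have := congrFun hcolJ m
        rw [col_apply, ← h, Pi.smul_apply, hvtri m (h ▸ hm), smul_zero] at this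
        exact this
      · have := congrFun (hcol i h) m
        rw [col_apply, col_apply, htri m i (hlt i hi h) hm] at this
        exact this
    · intro i i' hi hi'
      by_cases h : i = J <;> by_cases h' : i' = J
      · rw [h, h', hcolJ, if_pos rfl, mulVec_smul, dotProduct_smul, smul_dotProduct, smul_smul,
          ← mul_inv, Real.mul_self_sqrt hpos.le, smul_eq_mul, inv_mul_cancel₀ hpos.ne']
      · rw [h, hcolJ, hcol i' h', hsymm, mulVec_smul, dotProduct_smul,
          hperp i' (hlt i' hi' h'), smul_zero, if_neg (Ne.symm h')]
      · rw [h', hcolJ, hcol i h, mulVec_smul, dotProduct_smul, hperp i (hlt i hi h), smul_zero,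
          if_neg h]
      · rw [hcol i h, hcol i' h', horth i i' (hlt i hi h) (hlt i' hi' h')]

theorem gramSchmidt_transpose_mul_mul {S : Matrix (Fin k) (Fin k) ℝ} (hS : S.PosDef) :
    (gramSchmidt S).valᵀ * S * (gramSchmidt S).val = 1 := by
  ext i i'
  rw [Matrix.mul_assoc, mul_apply_eq_vecMul, one_apply,
    ← (gramSchmidtUpTo_spec hS k le_rfl).2 i i' i.isLt i'.isLt]
  simp only [vecMul, dotProduct, mul_apply, mulVec, gramSchmidt]
  rfl

end GramSchmidt

/-! ### Block-sparse operations: values and costs -/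

namespace BlockSparse

open Matrix

variable {n k : ℕ}

theorem get_of_mem (A : BlockSparse n k) {i j : Fin n} (h : (i, j) ∈ A.pat) :
    A.get i j = A.blk i j :=
  if_pos h

theorem get_of_notMem (A : BlockSparse n k) {i j : Fin n} (h : (i, j) ∉ A.pat) :
    A.get i j = 0 :=
  if_neg h

theorem toMatrix_apply (A : BlockSparse n k) (p q : Fin n × Fin k) :
    A.toMatrix p q = A.get p.1 q.1 p.2 q.2 := rfl

theorem hasPattern_toMatrix {T : Finset (Fin n × Fin n)} {A : BlockSparse n k}
    (h : A.pat ⊆ T) : HasPattern T A.toMatrix := by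
  intro i j hij a b
  rw [toMatrix_apply, get_of_notMem A fun h' => hij (h h')]
  rfl

theorem toMatrix_ofMatrix {T : Finset (Fin n × Fin n)}
    {S : Matrix (Fin n × Fin k) (Fin n × Fin k) ℝ} (h : HasPattern T S) :
    (ofMatrix T S).toMatrix = S := by
  ext ⟨i, a⟩ ⟨j, b⟩
  rw [toMatrix_apply, get]
  split_ifs with hij
  · rfl
  · exact (h i j hij a b).symm

theorem toMatrix_empty : (empty : BlockSparse n k).toMatrix = 0 := by
  ext p q
  simp [toMatrix_apply, get, empty]

theorem toMatrix_transpose (A : BlockSparse n k) : A.transpose.toMatrix = A.toMatrixᵀ := by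
  ext ⟨i, a⟩ ⟨j, b⟩
  have : (i, j) ∈ A.transpose.pat ↔ (j, i) ∈ A.pat := by
    simp [BlockSparse.transpose]
  simp only [toMatrix_apply, transpose_apply, get, this]
  split_ifs <;> rfl

/-- The coordinate projection onto the blocks with index in `U`. -/
def blockProj (k : ℕ) (U : Finset (Fin n)) : Matrix (Fin n × Fin k) (Fin n × Fin k) ℝ :=
  diagonal fun p => if p.1 ∈ U then 1 else 0

theorem transpose_blockProj (U : Finset (Fin n)) : (blockProj k U)ᵀ = blockProj k U :=
  diagonal_transpose _

theorem blockProj_mul_blockProj (U : Finset (Fin n)) :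
    blockProj k U * blockProj k U = blockProj k U := by
  simp [blockProj, diagonal_mul_diagonal]

theorem blockProj_mul_blockProj_of_disjoint {U V : Finset (Fin n)} (h : Disjoint U V) :
    blockProj k U * blockProj k V = 0 := by
  rw [blockProj, blockProj, diagonal_mul_diagonal, ← diagonal_zero]
  congr 1
  funext p
  by_cases hp : p.1 ∈ U
  · simp [Finset.disjoint_left.1 h hp]
  · simp [hp]

theorem blockProj_union {U V : Finset (Fin n)} (h : Disjoint U V) :
    blockProj k (U ∪ V) = blockProj k U + blockProj k V := by
  rw [blockProj, blockProj, blockProj, diagonal_add]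
  congr 1
  funext p
  by_cases hp : p.1 ∈ U
  · simp [hp, Finset.disjoint_left.1 h hp]
  · simp [hp]

theorem blockProj_univ : blockProj k (Finset.univ : Finset (Fin n)) = 1 := by
  simp [blockProj]

theorem toMatrix_restrict (R C : Finset (Fin n)) (A : BlockSparse n k) :
    (A.restrict R C).toMatrix = blockProj k R * A.toMatrix * blockProj k C := by
  ext ⟨i, a⟩ ⟨j, b⟩
  rw [blockProj, blockProj, mul_diagonal, diagonal_mul]
  simp only [toMatrix_apply, get, restrict, Finset.mem_inter, Finset.mem_product]
  by_cases h : (i, j) ∈ A.pat <;> by_cases hi : i ∈ R <;> by_cases hj : j ∈ C <;> simp [h, hi, hj]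

theorem blockProj_mul_toMatrix {U : Finset (Fin n)} {A : BlockSparse n k}
    (h : ∀ i j, (i, j) ∈ A.pat → i ∈ U) : blockProj k U * A.toMatrix = A.toMatrix := by
  ext ⟨i, a⟩ ⟨j, b⟩
  rw [blockProj, diagonal_mul, toMatrix_apply]
  by_cases hi : i ∈ U
  · simp [hi]
  · simp [hi, get_of_notMem A fun h' => hi (h i j h')]

theorem toMatrix_mul_blockProj {U : Finset (Fin n)} {A : BlockSparse n k}
    (h : ∀ i j, (i, j) ∈ A.pat → j ∈ U) : A.toMatrix * blockProj k U = A.toMatrix := by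
  ext ⟨i, a⟩ ⟨j, b⟩
  rw [blockProj, mul_diagonal, toMatrix_apply]
  by_cases hj : j ∈ U
  · simp [hj]
  · simp [hj, get_of_notMem A fun h' => hj (h i j h')]

theorem toMatrix_merge {A B : BlockSparse n k} (h : Disjoint A.pat B.pat) :
    (A.merge B).toMatrix = A.toMatrix + B.toMatrix := by
  ext ⟨i, a⟩ ⟨j, b⟩
  rw [Matrix.add_apply]
  simp only [toMatrix_apply, get, merge, Finset.mem_union]
  by_cases hA : (i, j) ∈ A.pat
  · simp [hA, Finset.disjoint_left.1 h hA]
  · by_cases hB : (i, j) ∈ B.pat <;> simp [hA, hB]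

theorem mem_inner {A B : BlockSparse n k} {i j m : Fin n} :
    m ∈ inner A B i j ↔ (i, m) ∈ A.pat ∧ (m, j) ∈ B.pat := by
  simp [inner]

theorem mem_pat_mul {A B : BlockSparse n k} {i j : Fin n} :
    (i, j) ∈ (A.mul B).val.pat ↔ ∃ m, (i, m) ∈ A.pat ∧ (m, j) ∈ B.pat := by
  simp [BlockSparse.mul, Finset.Nonempty, mem_inner]

theorem toMatrix_mul (A B : BlockSparse n k) :
    (A.mul B).val.toMatrix = A.toMatrix * B.toMatrix := by
  ext ⟨i, a⟩ ⟨j, b⟩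
  have h1 : (A.mul B).val.toMatrix (i, a) (j, b) =
      ∑ mc ∈ inner A B i j ×ˢ Finset.univ, A.blk i mc.1 a mc.2 * B.blk mc.1 j mc.2 b := by
    rw [toMatrix_apply, get]
    split_ifs with h
    · have h' : (inner A B i j).Nonempty := by simpa [BlockSparse.mul] using h
      simp [BlockSparse.mul, h', Flop.sum, Flop.mul]
    · have h' : inner A B i j = ∅ := by
        simpa [BlockSparse.mul, Finset.not_nonempty_iff_eq_empty] using h
      simp [h']
  rw [h1, Matrix.mul_apply]
  refine Finset.sum_subset_zero_on_sdiff (Finset.subset_univ _) ?_ ?_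
  · rintro ⟨m, c⟩ hm
    have hm' : ¬ ((i, m) ∈ A.pat ∧ (m, j) ∈ B.pat) := by
      simpa [mem_inner] using hm
    simp only [toMatrix_apply, get]
    by_cases hA : (i, m) ∈ A.pat
    · have hB : (m, j) ∉ B.pat := fun hB => hm' ⟨hA, hB⟩
      simp [hB]
    · simp [hA]
  · rintro ⟨m, c⟩ hm
    have hm' : (i, m) ∈ A.pat ∧ (m, j) ∈ B.pat := by
      simpa [mem_inner] using hm
    simp [toMatrix_apply, get, hm']

/-- The pairs of stored blocks of `A` and `B` that are multiplied when `A * B` is computed: the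
element `⟨(i, j), m⟩` stands for the product of the blocks at `(i, m)` and `(m, j)`. -/
def products (A B : BlockSparse n k) : Finset (Σ _ : Fin n × Fin n, Fin n) :=
  Finset.univ.sigma fun p => inner A B p.1 p.2

theorem mem_products {A B : BlockSparse n k} {x : Σ _ : Fin n × Fin n, Fin n} :
    x ∈ products A B ↔ (x.1.1, x.2) ∈ A.pat ∧ (x.2, x.1.2) ∈ B.pat := by
  simp [products, mem_inner]

theorem cost_mul_le (A B : BlockSparse n k) :
    (A.mul B).cost ≤ (products A B).card * (2 * k ^ 3) := by
  have h : (A.mul B).cost =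
      ∑ p ∈ Finset.univ.filter fun p : Fin n × Fin n => (inner A B p.1 p.2).Nonempty,
        (inner A B p.1 p.2).card * (2 * k ^ 3) := by
    simp only [BlockSparse.mul, Flop.cost_bind, Flop.cost_forEntries, Flop.cost_pure, add_zero]
    refine Finset.sum_congr rfl fun p _ => ?_
    simp only [Flop.sum, Flop.mul, Finset.sum_const, Finset.card_product, Finset.card_univ,
      Fintype.card_prod, Fintype.card_fin, smul_eq_mul]
    ring
  rw [h, ← Finset.sum_mul, products, Finset.card_sigma]
  exact Nat.mul_le_mul_right _ (Finset.sum_le_sum_of_subset (Finset.filter_subset _ _))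

theorem pat_sub (A B : BlockSparse n k) : (A.sub B).val.pat = A.pat ∪ B.pat := rfl

theorem toMatrix_sub (A B : BlockSparse n k) :
    (A.sub B).val.toMatrix = A.toMatrix - B.toMatrix := by
  ext ⟨i, a⟩ ⟨j, b⟩
  rw [Matrix.sub_apply, toMatrix_apply, get, pat_sub]
  by_cases hB : (i, j) ∈ B.pat
  · simp [hB, BlockSparse.sub, Flop.sub, toMatrix_apply]
  · by_cases hA : (i, j) ∈ A.pat
    · simp [hB, hA, BlockSparse.sub, toMatrix_apply, get_of_notMem B hB]
    · simp [hB, hA, toMatrix_apply, get_of_notMem B hB, get_of_notMem A hA]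

theorem cost_sub (A B : BlockSparse n k) : (A.sub B).cost = B.pat.card * k ^ 2 := by
  have h : (A.sub B).cost = ∑ p ∈ A.pat ∪ B.pat, if p ∈ B.pat then k ^ 2 else 0 := by
    simp only [BlockSparse.sub, Flop.cost_bind, Flop.cost_forEntries, Flop.cost_pure, add_zero]
    refine Finset.sum_congr rfl fun p _ => ?_
    split_ifs
    · simp [Flop.sub, sq]
    · rfl
  rw [h, ← Finset.sum_filter, Finset.filter_mem_eq_inter, Finset.union_inter_cancel_right]
  simp

/-- The block-diagonal matrix with diagonal blocks `D i`. -/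
def blockDiag (D : Fin n → Matrix (Fin k) (Fin k) ℝ) :
    Matrix (Fin n × Fin k) (Fin n × Fin k) ℝ :=
  (blockDiagonal D).submatrix Prod.swap Prod.swap

theorem blockDiag_apply (D : Fin n → Matrix (Fin k) (Fin k) ℝ) (p q : Fin n × Fin k) :
    blockDiag D p q = if p.1 = q.1 then D p.1 p.2 q.2 else 0 := rfl

theorem blockDiag_mul (D D' : Fin n → Matrix (Fin k) (Fin k) ℝ) :
    blockDiag D * blockDiag D' = blockDiag fun i => D i * D' i := by
  rw [blockDiag, blockDiag, blockDiag, blockDiagonal_mul]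
  exact submatrix_mul_equiv _ _ _ (Equiv.prodComm _ _) _

theorem transpose_blockDiag (D : Fin n → Matrix (Fin k) (Fin k) ℝ) :
    (blockDiag D)ᵀ = blockDiag fun i => (D i)ᵀ := by
  rw [blockDiag, blockDiag, ← blockDiagonal_transpose, transpose_submatrix]

theorem blockProj_eq_blockDiag (U : Finset (Fin n)) :
    blockProj k U = blockDiag fun i => if i ∈ U then 1 else 0 := by
  ext ⟨i, a⟩ ⟨j, b⟩
  rw [blockProj, diagonal_apply, blockDiag_apply]
  by_cases hij : i = j
  · by_cases hi : i ∈ U <;> simp [hij, hij ▸ hi, Matrix.one_apply]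
  · simp [hij]

theorem toMatrix_eq_blockDiag {A : BlockSparse n k} (h : ∀ i j, (i, j) ∈ A.pat → i = j) :
    A.toMatrix = blockDiag fun i => A.get i i := by
  ext ⟨i, a⟩ ⟨j, b⟩
  rw [toMatrix_apply, blockDiag_apply]
  by_cases hij : i = j
  · simp [hij]
  · simp [hij, get_of_notMem A fun h' => hij (h i j h')]

theorem mem_pat_orthDiag {L : Finset (Fin n)} {A : BlockSparse n k} {i j : Fin n} :
    (i, j) ∈ (orthDiag L A).val.pat ↔ i ∈ L ∧ i = j := by
  simp only [orthDiag, Flop.val_bind, Flop.val_pure, Finset.mem_image, Prod.mk.injEq]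
  constructor
  · rintro ⟨m, hm, rfl, rfl⟩
    exact ⟨hm, rfl⟩
  · rintro ⟨hi, rfl⟩
    exact ⟨i, hi, rfl, rfl⟩

theorem cost_orthDiag_le (L : Finset (Fin n)) (A : BlockSparse n k) :
    (orthDiag L A).cost ≤ L.card * (11 * k ^ 3) := by
  simp only [orthDiag, Flop.cost_bind, Flop.forEach, Flop.cost_pure, add_zero]
  exact Finset.sum_le_card_nsmul _ _ _ fun i _ => gramSchmidt_cost_le _

/-- Blockwise Gram-Schmidt is correct on a gramian `A` that is block-diagonal. -/
theorem orthDiag_transpose_mul_mul {L : Finset (Fin n)} {A : BlockSparse n k}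
    (hA : ∀ i j, (i, j) ∈ A.pat → i = j) (hpos : ∀ i ∈ L, (A.get i i).PosDef) :
    (orthDiag L A).val.toMatrixᵀ * A.toMatrix * (orthDiag L A).val.toMatrix = blockProj k L := by
  rw [toMatrix_eq_blockDiag hA, toMatrix_eq_blockDiag fun i j h => (mem_pat_orthDiag.1 h).2,
    transpose_blockDiag, blockDiag_mul, blockDiag_mul, blockProj_eq_blockDiag]
  congr 1
  funext i
  by_cases hi : i ∈ L
  · rw [if_pos hi, get_of_mem _ (mem_pat_orthDiag.2 ⟨hi, rfl⟩),
      ← gramSchmidt_transpose_mul_mul (hpos i hi)]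
    simp [orthDiag, Flop.forEach, hi]
  · rw [if_neg hi, get_of_notMem _ fun h => hi (mem_pat_orthDiag.1 h).1, Matrix.mul_zero]

/-- The diagonal blocks of `Wᵀ S W` are positive definite where `W` agrees with the identity. -/
theorem posDef_get_of_toMatrix_eq {S W : Matrix (Fin n × Fin k) (Fin n × Fin k) ℝ}
    (hS : S.PosDef) {L : Finset (Fin n)} (hW : blockProj k L * W = blockProj k L)
    {A : BlockSparse n k} (hA : A.toMatrix = Wᵀ * S * W) {i : Fin n} (hi : i ∈ L) :
    (A.get i i).PosDef := by
  have hsub : A.get i i = (W.submatrix id (Prod.mk i))ᴴ * S * W.submatrix id (Prod.mk i) := by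
    have h := congrArg (fun M => M.submatrix (Prod.mk i) (Prod.mk i)) hA
    have h' : A.toMatrix.submatrix (Prod.mk i) (Prod.mk i) = A.get i i := rfl
    rw [← h', conjTranspose_eq_transpose_of_trivial]
    exact h
  rw [hsub]
  refine hS.conjTranspose_mul_mul_same fun x y hxy => ?_
  have key : ∀ z : Fin k → ℝ, ∀ a, (W.submatrix id (Prod.mk i) *ᵥ z) (i, a) = z a := by
    intro z a
    have hrow : ∀ b, W (i, a) (i, b) = if a = b then 1 else 0 := by
      intro b
      have h := congrFun (congrFun hW (i, a)) (i, b)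
      rw [blockProj, diagonal_mul, diagonal_apply] at h
      simpa [hi] using h
    simp [mulVec, dotProduct, hrow]
  funext a
  rw [← key x a, ← key y a]
  exact congrFun hxy (i, a)

end BlockSparse

/-! ### One step of block Gram-Schmidt -/

section BlockElimination

open Matrix

variable {ι : Type} [Fintype ι]

/-- The columns `F` of new coordinate vectors, made orthogonal to the columns of `P`, have the
Schur-type gramian that the algorithm computes. Inverting `P` is not needed for that. -/
theorem residual_gramian {S P E F : Matrix ι ι ℝ} (hS : Sᵀ = S) (hF : Fᵀ = F)
    (hE : Eᵀ = E) (hPE : P * E = P) (hP : Pᵀ * S * P = E) :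
    (F - P * (Pᵀ * S * F))ᵀ * S * (F - P * (Pᵀ * S * F)) =
      F * S * F - (Pᵀ * S * F)ᵀ * (Pᵀ * S * F) := by
  have hEP : E * Pᵀ = Pᵀ := by
    have := congrArg Matrix.transpose hPE
    rwa [transpose_mul, hE] at this
  have h1 : (Pᵀ * S * F)ᵀ = F * S * P := by
    simp only [transpose_mul, transpose_transpose, hS, hF, Matrix.mul_assoc]
  have h2 : Pᵀ * S * (P * (Pᵀ * S * F)) = Pᵀ * S * F := by
    calc Pᵀ * S * (P * (Pᵀ * S * F)) = (Pᵀ * S * P) * Pᵀ * S * F := by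
          simp only [Matrix.mul_assoc]
      _ = Pᵀ * S * F := by rw [hP, hEP]
  have h3 : Pᵀ * S * (F - P * (Pᵀ * S * F)) = 0 := by
    rw [Matrix.mul_sub, h2, sub_self]
  calc (F - P * (Pᵀ * S * F))ᵀ * S * (F - P * (Pᵀ * S * F))
      = F * S * (F - P * (Pᵀ * S * F)) -
          (Pᵀ * S * F)ᵀ * (Pᵀ * S * (F - P * (Pᵀ * S * F))) := by
        rw [transpose_sub, hF, transpose_mul]
        simp only [Matrix.sub_mul, Matrix.mul_assoc]
    _ = F * S * F - (Pᵀ * S * F)ᵀ * (Pᵀ * S * F) := by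
        rw [h3, Matrix.mul_zero, sub_zero, Matrix.mul_sub, h1]
        simp only [Matrix.mul_assoc]

/-- If `G` orthonormalizes the residual vectors, then the columns of `P` together with the
orthonormalized residuals are orthonormal. -/
theorem extended_gramian {S P E F G : Matrix ι ι ℝ} (hS : Sᵀ = S) (hF : Fᵀ = F)
    (hE : Eᵀ = E) (hPE : P * E = P) (hP : Pᵀ * S * P = E) (hFG : F * G = G)
    (hG : Gᵀ * (F * S * F - (Pᵀ * S * F)ᵀ * (Pᵀ * S * F)) * G = F) :
    (P + (0 - P * (Pᵀ * S * F) * G) + G)ᵀ * S * (P + (0 - P * (Pᵀ * S * F) * G) + G) =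
      E + F := by
  set W := F - P * (Pᵀ * S * F) with hW
  have hEP : E * Pᵀ = Pᵀ := by
    have := congrArg Matrix.transpose hPE
    rwa [transpose_mul, hE] at this
  have h2 : Pᵀ * S * W = 0 := by
    rw [hW, Matrix.mul_sub]
    have : Pᵀ * S * (P * (Pᵀ * S * F)) = (Pᵀ * S * P) * Pᵀ * S * F := by
      simp only [Matrix.mul_assoc]
    rw [this, hP, hEP, sub_self]
  have h3 : Wᵀ * S * P = 0 := by
    have := congrArg Matrix.transpose h2
    simpa only [transpose_mul, transpose_transpose, hS, transpose_zero, Matrix.mul_assoc]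
      using this
  have h4 : P + (0 - P * (Pᵀ * S * F) * G) + G = P + W * G := by
    rw [hW, Matrix.sub_mul, hFG]
    abel
  rw [← residual_gramian hS hF hE hPE hP, ← hW] at hG
  calc _ = Pᵀ * S * P + Pᵀ * S * W * G + Gᵀ * (Wᵀ * S * P) + Gᵀ * (Wᵀ * S * W) * G := by
        rw [h4, transpose_add, transpose_mul]
        simp only [Matrix.add_mul, Matrix.mul_add, Matrix.mul_assoc]
        abel
    _ = E + F := by
        rw [hP, h2, h3, hG, Matrix.zero_mul, Matrix.mul_zero, add_zero, add_zero]

end BlockElimination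

/-! ### Arithmetic of the dyadic pyramid -/

/-- `m` lies in the set `I'_{r,t+1}` centered at `j`, expressed through binary digits: `j` is an odd
multiple of `2 ^ t`, and `m` lies strictly between the same two multiples of `2 ^ (t + 1)`. -/
def InSubtree (t m j : ℕ) : Prop :=
  j % 2 ^ (t + 1) = 2 ^ t ∧ m / 2 ^ (t + 1) = j / 2 ^ (t + 1) ∧ m % 2 ^ (t + 1) ≠ 0

/-- `j` has level `t + 1`, and some neighbour of `j` lies in the subtree with the centre `c`, which
has a smaller level. These are the blocks that `Pᵀ Σ` has in level `t + 1`. -/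
def Touches (t c j : ℕ) : Prop :=
  j % 2 ^ (t + 1) = 2 ^ t ∧ ∃ s < t, ∃ i, (i = j + 1 ∨ i + 1 = j) ∧ InSubtree s i c

theorem eq_of_div_eq_of_mod_eq {a b d : ℕ} (h1 : a / d = b / d) (h2 : a % d = b % d) : a = b := by
  rw [← Nat.div_add_mod a d, ← Nat.div_add_mod b d, h1, h2]

theorem div_two_pow_eq_of_le {a b s t : ℕ} (hst : s ≤ t) (h : a / 2 ^ s = b / 2 ^ s) :
    a / 2 ^ t = b / 2 ^ t := by
  obtain ⟨u, rfl⟩ := Nat.exists_eq_add_of_le hst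
  rw [pow_add, ← Nat.div_div_eq_div_mul, ← Nat.div_div_eq_div_mul, h]

theorem mod_two_pow_ne_zero_of_le {a s t : ℕ} (hst : s ≤ t) (h : a % 2 ^ s ≠ 0) :
    a % 2 ^ t ≠ 0 := fun h' =>
  h (Nat.mod_eq_zero_of_dvd ((pow_dvd_pow 2 hst).trans (Nat.dvd_of_mod_eq_zero h')))

theorem mod_two_pow_eq_zero {a s t : ℕ} (hst : s ≤ t) (h : a % 2 ^ (t + 1) = 2 ^ t) :
    a % 2 ^ s = 0 := by
  rw [← Nat.mod_mod_of_dvd a (pow_dvd_pow 2 (hst.trans t.le_succ)), h]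
  exact Nat.mod_eq_zero_of_dvd (pow_dvd_pow 2 hst)

theorem mod_two_pow_ne_zero {a s t : ℕ} (hst : s < t) (h : a % 2 ^ (s + 1) = 2 ^ s) :
    a % 2 ^ t ≠ 0 :=
  mod_two_pow_ne_zero_of_le hst (h ▸ (by positivity))

theorem level_unique {a s t : ℕ} (hs : a % 2 ^ (s + 1) = 2 ^ s) (ht : a % 2 ^ (t + 1) = 2 ^ t) :
    s = t := by
  rcases lt_trichotomy s t with h | h | h
  · exact absurd (mod_two_pow_eq_zero le_rfl ht) (mod_two_pow_ne_zero h hs)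
  · exact h
  · exact absurd (mod_two_pow_eq_zero le_rfl hs) (mod_two_pow_ne_zero h ht)

theorem mod_two_pow_succ_ne_zero_iff {a t : ℕ} :
    a % 2 ^ (t + 1) ≠ 0 ↔ a % 2 ^ t ≠ 0 ∨ a % 2 ^ (t + 1) = 2 ^ t := by
  have hpos : 0 < 2 ^ t := by positivity
  rw [pow_succ, Nat.mod_mul]
  rcases Nat.mod_two_eq_zero_or_one (a / 2 ^ t) with h | h <;> rw [h] <;> omega

theorem InSubtree.self {t j : ℕ} (h : j % 2 ^ (t + 1) = 2 ^ t) : InSubtree t j j :=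
  ⟨h, rfl, h ▸ (by positivity)⟩

theorem InSubtree.eq_of_eq {t m j j' : ℕ} (h : InSubtree t m j) (h' : InSubtree t m j') :
    j = j' :=
  eq_of_div_eq_of_mod_eq (h.2.1.symm.trans h'.2.1) (h.1.trans h'.1.symm)

theorem neighbour_div {t i j : ℕ} (ht : 0 < t) (hj : j % 2 ^ (t + 1) = 2 ^ t)
    (hi : i = j + 1 ∨ i + 1 = j) : i / 2 ^ (t + 1) = j / 2 ^ (t + 1) := by
  obtain ⟨u, rfl⟩ := Nat.exists_eq_succ_of_ne_zero ht.ne'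
  have hpos : 0 < 2 ^ u := by positivity
  have hd := Nat.div_add_mod j (2 ^ (u + 1 + 1))
  rw [hj] at hd
  have e1 : 2 ^ (u + 1) = 2 * 2 ^ u := by ring
  have e2 : 2 ^ (u + 1 + 1) = 4 * 2 ^ u := by ring
  generalize hq : j / 2 ^ (u + 1 + 1) = q at *
  rw [Nat.succ_eq_add_one, Nat.div_eq_iff (by positivity)]
  rw [_root_.mul_comm] at hd
  omega

namespace Touches

variable {t c j : ℕ}

theorem div_eq (ht : 0 < t) (h : Touches t c j) : c / 2 ^ (t + 1) = j / 2 ^ (t + 1) := by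
  obtain ⟨hj, s, hs, i, hi, h⟩ := h
  rw [← neighbour_div ht hj hi]
  exact (div_two_pow_eq_of_le (by omega) h.2.1).symm

theorem eq_of_eq {j' : ℕ} (ht : 0 < t) (h : Touches t c j) (h' : Touches t c j') : j = j' :=
  eq_of_div_eq_of_mod_eq ((h.div_eq ht).symm.trans (h'.div_eq ht)) (h.1.trans h'.1.symm)

/-- A subtree that does not contain `j` lies on one side of `j`. -/
theorem side {s i : ℕ} (hj : j % 2 ^ (t + 1) = 2 ^ t) (hs : s < t)
    (hi : i = j + 1 ∨ i + 1 = j) (h : InSubtree s i c) :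
    i = if c < j then j - 1 else j + 1 := by
  have hj0 : j % 2 ^ (s + 1) = 0 := mod_two_pow_eq_zero hs hj
  have hjpos : 0 < j := Nat.pos_of_ne_zero fun h0 => by
    rw [h0, Nat.zero_mod] at hj
    exact absurd hj.symm (by positivity)
  have hc0 : c % 2 ^ (s + 1) ≠ 0 := mod_two_pow_ne_zero s.lt_succ_self h.1
  have hpos : 0 < 2 ^ s := by positivity
  have hd : 2 ^ (s + 1) = 2 * 2 ^ s := by ring
  have hic := h.2.1
  have hne : c ≠ j := fun h' => hc0 (h' ▸ hj0)
  rcases hi with rfl | rfl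
  · have : (j + 1) / 2 ^ (s + 1) = j / 2 ^ (s + 1) :=
      Nat.succ_div_of_not_dvd fun hdvd => by
        have := (Nat.dvd_add_right (Nat.dvd_of_mod_eq_zero hj0)).1 hdvd
        have := Nat.le_of_dvd one_pos this
        omega
    have hle : j ≤ c := by
      rw [← Nat.div_mul_cancel (Nat.dvd_of_mod_eq_zero hj0), ← this, hic]
      exact Nat.div_mul_le_self _ _
    rw [if_neg (by omega)]
  · have : (i + 1) / 2 ^ (s + 1) = i / 2 ^ (s + 1) + 1 :=
      Nat.succ_div_of_dvd (Nat.dvd_of_mod_eq_zero hj0)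
    have hle : c < i + 1 := by
      by_contra hcon
      have := Nat.div_le_div_right (c := 2 ^ (s + 1)) (not_lt.1 hcon)
      omega
    rw [if_pos hle]
    omega

end Touches

theorem mem_level {N t : ℕ} (ht : t < N) {i : Fin (2 ^ N - 1)} :
    i ∈ level N (t + 1) ↔ (i.val + 1) % 2 ^ (t + 1) = 2 ^ t := by
  have hpos : 0 < 2 ^ t := by positivity
  have hpow : 2 ^ (t + 1) = 2 * 2 ^ t := by ring
  rw [level, Finset.mem_filter]
  simp only [node, Finset.mem_univ, true_and, Finset.mem_image, Finset.mem_Icc,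
    Nat.add_sub_cancel]
  constructor
  · rintro ⟨r, ⟨hr, -⟩, h⟩
    obtain ⟨q, rfl⟩ := Nat.exists_eq_add_of_le' hr
    have : i.val + 1 = 2 ^ t + 2 ^ (t + 1) * q := by
      rw [← h, show 2 * (q + 1) - 1 = 2 * q + 1 by omega]
      ring
    rw [this, Nat.add_mul_mod_self_left, Nat.mod_eq_of_lt (by omega)]
  · intro h
    refine ⟨(i.val + 1) / 2 ^ (t + 1) + 1, ⟨Nat.le_add_left _ _, ?_⟩, ?_⟩
    · have hi := i.isLt
      rw [Nat.succ_le_iff, Nat.div_lt_iff_lt_mul (by positivity), ← pow_add,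
        Nat.sub_add_cancel ht]
      omega
    · have hd := Nat.div_add_mod (i.val + 1) (2 ^ (t + 1))
      rw [h] at hd
      rw [show ∀ q, 2 * (q + 1) - 1 = 2 * q + 1 by omega]
      refine Eq.trans ?_ hd
      rw [pow_succ]
      ring

theorem levelsBelow_succ (N t : ℕ) :
    levelsBelow N (t + 2) = levelsBelow N (t + 1) ∪ level N (t + 1) := by
  ext i
  simp only [levelsBelow, Finset.mem_biUnion, Finset.mem_Ico, Finset.mem_union]
  constructor
  · rintro ⟨l, ⟨h1, h2⟩, hi⟩
    rcases Nat.lt_succ_iff_lt_or_eq.1 h2 with h | rfl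
    · exact Or.inl ⟨l, ⟨h1, h⟩, hi⟩
    · exact Or.inr hi
  · rintro (⟨l, ⟨h1, h2⟩, hi⟩ | hi)
    · exact ⟨l, ⟨h1, by omega⟩, hi⟩
    · exact ⟨t + 1, ⟨by omega, by omega⟩, hi⟩

theorem levelsBelow_one (N : ℕ) : levelsBelow N 1 = ∅ := by
  simp [levelsBelow]

theorem mem_levelsBelow {N t : ℕ} (ht : t ≤ N) {i : Fin (2 ^ N - 1)} :
    i ∈ levelsBelow N (t + 1) ↔ (i.val + 1) % 2 ^ t ≠ 0 := by
  induction t with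
  | zero => simp [levelsBelow_one, Nat.mod_one]
  | succ t ih =>
    rw [levelsBelow_succ, Finset.mem_union, ih (by omega), mem_level (by omega),
      mod_two_pow_succ_ne_zero_iff]

theorem disjoint_levelsBelow_level {N t : ℕ} (ht : t < N) :
    Disjoint (levelsBelow N (t + 1)) (level N (t + 1)) :=
  Finset.disjoint_left.2 fun _ h h' =>
    (mem_levelsBelow ht.le).1 h (mod_two_pow_eq_zero le_rfl ((mem_level ht).1 h'))

theorem levelsBelow_eq_univ (N : ℕ) : levelsBelow N (N + 1) = Finset.univ := by
  refine Finset.eq_univ_of_forall fun i => (mem_levelsBelow le_rfl).2 ?_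
  have := i.isLt
  rw [Nat.mod_eq_of_lt (by omega)]
  omega

theorem mem_verticallyDyadic {N t : ℕ} (ht : t < N) {i j : Fin (2 ^ N - 1)}
    (h : InSubtree t (i.val + 1) (j.val + 1)) : (i, j) ∈ verticallyDyadic N := by
  obtain ⟨hj, hij, hi⟩ := h
  have hL := (mem_level ht).2 hj
  simp only [level, Finset.mem_filter, Finset.mem_univ, true_and, Finset.mem_image] at hL
  obtain ⟨r, hr, hrj⟩ := hL
  simp only [verticallyDyadic, Finset.mem_filter, Finset.mem_univ, true_and]
  refine ⟨t + 1, Finset.mem_Icc.2 ⟨by omega, ht⟩, r, hr, ?_, hrj.symm⟩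
  rw [subtree, hrj, Finset.mem_Icc, Nat.add_sub_cancel]
  have hpos : 0 < 2 ^ t := by positivity
  have hpow : 2 ^ (t + 1) = 2 * 2 ^ t := by ring
  have hdj := Nat.div_add_mod (j.val + 1) (2 ^ (t + 1))
  have hdi := Nat.div_add_mod (i.val + 1) (2 ^ (t + 1))
  have hlt := Nat.mod_lt (i.val + 1) (y := 2 ^ (t + 1)) (by positivity)
  rw [hij] at hdi
  omega

/-! ### Block patterns and numbers of block products in one step -/

namespace BlockSparse

/-- The pattern of `P` after the levels `1, …, t`: the part of `VD(N)` in these columns. -/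
def IsDyadicBelow {N k : ℕ} (t : ℕ) (P : BlockSparse (2 ^ N - 1) k) : Prop :=
  ∀ i j, (i, j) ∈ P.pat → ∃ s < t, InSubtree s (i.val + 1) (j.val + 1)

section Patterns

variable {N k t : ℕ} {P S : BlockSparse (2 ^ N - 1) k}

theorem mem_pat_transpose {n : ℕ} {A : BlockSparse n k} {i j : Fin n} :
    (i, j) ∈ A.transpose.pat ↔ (j, i) ∈ A.pat := by
  simp [BlockSparse.transpose]

theorem IsDyadicBelow.mem_levelsBelow_left (hP : P.IsDyadicBelow t) (ht : t ≤ N)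
    {i j : Fin (2 ^ N - 1)} (h : (i, j) ∈ P.pat) : i ∈ levelsBelow N (t + 1) := by
  obtain ⟨s, hs, h⟩ := hP i j h
  exact (mem_levelsBelow ht).2 (mod_two_pow_ne_zero_of_le hs h.2.2)

theorem IsDyadicBelow.mem_levelsBelow_right (hP : P.IsDyadicBelow t) (ht : t ≤ N)
    {i j : Fin (2 ^ N - 1)} (h : (i, j) ∈ P.pat) : j ∈ levelsBelow N (t + 1) := by
  obtain ⟨s, hs, h⟩ := hP i j h
  exact (mem_levelsBelow ht).2 (mod_two_pow_ne_zero hs h.1)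

/-- The stored part of `Σ` in the rows of smaller levels and the columns of level `t + 1`. -/
theorem mem_pat_restrict_levelsBelow (hS : S.pat ⊆ tridiagonal (2 ^ N - 1)) (ht : t < N)
    {i j : Fin (2 ^ N - 1)}
    (h : (i, j) ∈ (S.restrict (levelsBelow N (t + 1)) (level N (t + 1))).pat) :
    (j.val + 1) % 2 ^ (t + 1) = 2 ^ t ∧
      (i.val + 1 = j.val + 1 + 1 ∨ i.val + 1 + 1 = j.val + 1) := by
  simp only [restrict, Finset.mem_inter, Finset.mem_product] at h
  obtain ⟨hij, hi, hj⟩ := h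
  have h1 := hS hij
  simp only [tridiagonal, Finset.mem_filter, Finset.mem_univ, true_and] at h1
  have h2 : i.val ≠ j.val := fun he => by
    rw [Fin.ext he] at hi
    exact Finset.disjoint_left.1 (disjoint_levelsBelow_level ht) hi hj
  exact ⟨(mem_level ht).1 hj, by omega⟩

theorem diagonal_of_mem_pat_restrict_level (hS : S.pat ⊆ tridiagonal (2 ^ N - 1)) (ht : t < N)
    {i j : Fin (2 ^ N - 1)} (h : (i, j) ∈ (S.restrict (level N (t + 1)) (level N (t + 1))).pat) :
    i = j := by
  simp only [restrict, Finset.mem_inter, Finset.mem_product] at h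
  obtain ⟨hij, hi, hj⟩ := h
  have h1 := hS hij
  simp only [tridiagonal, Finset.mem_filter, Finset.mem_univ, true_and] at h1
  have hi'' := (mem_level ht).1 hi
  have hj'' := (mem_level ht).1 hj
  -- Indices of the same level have the same parity, so they are not neighbours.
  have hpar : ∀ m, m % 2 ^ (t + 1) = 2 ^ t → m % 2 = 2 ^ t % 2 := fun m hm => by
    rw [← hm, Nat.mod_mod_of_dvd _ (dvd_pow_self 2 t.succ_ne_zero)]
  have h3 := hpar _ hi''
  have h4 := hpar _ hj''
  exact Fin.ext (by omega)

/-- The pattern of `Pᵀ Σ` in the columns of level `t + 1`. -/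
def IsTouching (t : ℕ) (A : BlockSparse (2 ^ N - 1) k) : Prop :=
  ∀ c j, (c, j) ∈ A.pat → Touches t (c.val + 1) (j.val + 1)

theorem isTouching_mul (hS : S.pat ⊆ tridiagonal (2 ^ N - 1)) (ht : t < N)
    (hP : P.IsDyadicBelow t) :
    (P.transpose.mul (S.restrict (levelsBelow N (t + 1)) (level N (t + 1)))).val.IsTouching t := by
  intro c j h
  obtain ⟨i, hci, hij⟩ := mem_pat_mul.1 h
  obtain ⟨s, hs, h⟩ := hP i c (mem_pat_transpose.1 hci)
  obtain ⟨hj, hi⟩ := mem_pat_restrict_levelsBelow hS ht hij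
  exact ⟨hj, s, hs, i.val + 1, hi, h⟩

theorem card_products_transpose_mul_le (hS : S.pat ⊆ tridiagonal (2 ^ N - 1)) (ht0 : 0 < t)
    (ht : t < N) (hP : P.IsDyadicBelow t) :
    (products P.transpose (S.restrict (levelsBelow N (t + 1)) (level N (t + 1)))).card ≤ 2 ^ N := by
  have key : (products P.transpose
      (S.restrict (levelsBelow N (t + 1)) (level N (t + 1)))).card ≤
      (Finset.univ : Finset (Fin (2 ^ N - 1))).card := by
    -- The row `c` determines the column `j`, and then the side of `j` on which `i` lies.
    refine Finset.card_le_card_of_injOn (fun x => x.1.1) (fun _ _ => Finset.mem_univ _) ?_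
    rintro ⟨⟨c, j⟩, i⟩ hx ⟨⟨c', j'⟩, i'⟩ hx' (rfl : c = c')
    obtain ⟨hci, hij⟩ := mem_products.1 hx
    obtain ⟨hci', hij'⟩ := mem_products.1 hx'
    obtain ⟨s, hs, h⟩ := hP i c (mem_pat_transpose.1 hci)
    obtain ⟨s', hs', h'⟩ := hP i' c (mem_pat_transpose.1 hci')
    obtain ⟨hj, hi⟩ := mem_pat_restrict_levelsBelow hS ht hij
    obtain ⟨hj', hi'⟩ := mem_pat_restrict_levelsBelow hS ht hij'
    have hjj : j = j' := by
      have : j.val + 1 = j'.val + 1 := Touches.eq_of_eq ht0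
        ⟨hj, s, hs, _, hi, h⟩ ⟨hj', s', hs', _, hi', h'⟩
      exact Fin.ext (by omega)
    subst hjj
    have hii : i = i' := by
      have h1 := Touches.side hj hs hi h
      have h2 : i'.val + 1 = _ := Touches.side hj' hs' hi' h'
      exact Fin.ext (by have : i.val + 1 = i'.val + 1 := h1.trans h2.symm; omega)
    rw [hii]
  rw [Finset.card_univ, Fintype.card_fin] at key
  exact key.trans (Nat.sub_le _ _)

/-- The number of block products in `P (Pᵀ Σ)`. A subtree of level `s + 1` has fewer than
`2 ^ (s + 1)` elements, and each `j` of level `t + 1` is next to at most two of them, so there are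
at most `2 ∑ s < t, 2 ^ (s + 1)` products for each `j`. The pairs of `s` and of an element of the
subtree are encoded as the number `2 ^ (s + 1) + i % 2 ^ (s + 1) < 2 ^ (t + 1)`. -/
theorem card_products_mul_isTouching_le {A : BlockSparse (2 ^ N - 1) k} (hA : A.IsTouching t)
    (ht : t < N) (hP : P.IsDyadicBelow t) : (products P A).card ≤ 2 * 2 ^ N := by
  have key : (products P A).card ≤
      ((Finset.univ : Finset Bool) ×ˢ Finset.range (2 ^ N)).card := by
    refine Finset.card_le_card_of_forall_subsingleton (fun x y => ∃ s < t,
      InSubtree s (x.1.1.val + 1) (x.2.val + 1) ∧ y.1 = decide (x.2.val + 1 < x.1.2.val + 1) ∧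
      y.2 = 2 ^ (t + 1) * ((x.1.2.val + 1) / 2 ^ (t + 1)) +
        (2 ^ (s + 1) + (x.1.1.val + 1) % 2 ^ (s + 1))) ?_ ?_
    · rintro ⟨⟨i, j⟩, c⟩ hx
      obtain ⟨hic, hcj⟩ := mem_products.1 hx
      obtain ⟨s, hs, h⟩ := hP i c hic
      refine ⟨(_, _), Finset.mem_product.2 ⟨Finset.mem_univ _, Finset.mem_range.2 ?_⟩,
        s, hs, h, rfl, rfl⟩
      have h1 : (i.val + 1) % 2 ^ (s + 1) < 2 ^ (s + 1) := Nat.mod_lt _ (by positivity)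
      have h2 : 2 ^ (s + 1) + 2 ^ (s + 1) ≤ 2 ^ (t + 1) := by
        rw [← two_mul, ← pow_succ']
        exact Nat.pow_le_pow_right two_pos (by omega)
      have h3 : (j.val + 1) / 2 ^ (t + 1) + 1 ≤ 2 ^ (N - (t + 1)) := by
        have := j.isLt
        rw [Nat.succ_le_iff, Nat.div_lt_iff_lt_mul (by positivity), ← pow_add,
          Nat.sub_add_cancel ht]
        omega
      have h4 := Nat.mul_le_mul_left (2 ^ (t + 1)) h3
      rw [← pow_add, Nat.add_sub_cancel' ht, Nat.mul_add, Nat.mul_one] at h4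
      simp only
      omega
    · rintro ⟨b, v⟩ - ⟨⟨i, j⟩, c⟩ ⟨hx, s, hs, h, hb, hv⟩
        ⟨⟨i', j'⟩, c'⟩ ⟨hx', s', hs', h', hb', hv'⟩
      obtain ⟨-, hcj⟩ := mem_products.1 hx
      obtain ⟨-, hcj'⟩ := mem_products.1 hx'
      have hT := hA c j hcj
      have hT' := hA c' j' hcj'
      simp only at h h' hb hb' hv hv'
      have bound : ∀ m u, u < t → 2 ^ (u + 1) + m % 2 ^ (u + 1) < 2 ^ (u + 2) ∧
          2 ^ (u + 2) ≤ 2 ^ (t + 1) := fun m u hu => by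
        refine ⟨?_, Nat.pow_le_pow_right two_pos (by omega)⟩
        have h1 : m % 2 ^ (u + 1) < 2 ^ (u + 1) := Nat.mod_lt _ (by positivity)
        have h2 : 2 ^ (u + 2) = 2 ^ (u + 1) + 2 ^ (u + 1) := by ring
        omega
      obtain ⟨b1, b2⟩ := bound (i.val + 1) s hs
      obtain ⟨b1', b2'⟩ := bound (i'.val + 1) s' hs'
      have hdiv : (j.val + 1) / 2 ^ (t + 1) = (j'.val + 1) / 2 ^ (t + 1) := by
        have e := congrArg (· / 2 ^ (t + 1)) (hv.symm.trans hv')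
        rwa [Nat.mul_add_div (by positivity), Nat.mul_add_div (by positivity),
          Nat.div_eq_of_lt (b1.trans_le b2), Nat.div_eq_of_lt (b1'.trans_le b2')] at e
      have hjj : j = j' := by
        have := eq_of_div_eq_of_mod_eq hdiv (hT.1.trans hT'.1.symm)
        exact Fin.ext (by omega)
      subst hjj
      have hcode : 2 ^ (s + 1) + (i.val + 1) % 2 ^ (s + 1) =
          2 ^ (s' + 1) + (i'.val + 1) % 2 ^ (s' + 1) := by omega
      have hss : s = s' := by
        rcases lt_trichotomy s s' with hlt | heq | hlt
        · have : 2 ^ (s + 2) ≤ 2 ^ (s' + 1) := Nat.pow_le_pow_right two_pos (by omega)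
          omega
        · exact heq
        · have : 2 ^ (s' + 2) ≤ 2 ^ (s + 1) := Nat.pow_le_pow_right two_pos (by omega)
          omega
      subst hss
      have hcc : c = c' := by
        obtain ⟨hj, u, hu, m, hm, hmc⟩ := hT
        obtain ⟨hj', u', hu', m', hm', hmc'⟩ := hT'
        have hus := level_unique hmc.1 h.1
        have hus' := level_unique hmc'.1 h'.1
        subst hus
        subst hus'
        have h1 := Touches.side hj hu hm hmc
        have h2 := Touches.side hj' hu' hm' hmc'
        have h3 : (c.val + 1 < j.val + 1) ↔ (c'.val + 1 < j.val + 1) :=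
          decide_eq_decide.1 (hb.symm.trans hb')
        simp only [h3] at h1
        rw [← h2] at h1
        subst h1
        have := hmc.eq_of_eq hmc'
        exact Fin.ext (by omega)
      subst hcc
      have hii : i = i' := by
        have := eq_of_div_eq_of_mod_eq (h.2.1.trans h'.2.1.symm) (by omega)
        exact Fin.ext (by omega)
      rw [hii]
  simpa using key

theorem card_le_of_injOn_fin {α : Type} {s : Finset α} (f : α → Fin (2 ^ N - 1))
    (hf : Set.InjOn f s) : s.card ≤ 2 ^ N := by
  have key := Finset.card_le_card_of_injOn f (fun _ _ => Finset.mem_univ _) hf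
  rw [Finset.card_univ, Fintype.card_fin] at key
  exact key.trans (Nat.sub_le _ _)

theorem IsTouching.diagonal {A : BlockSparse (2 ^ N - 1) k} (hA : A.IsTouching t) (ht0 : 0 < t)
    {j j' : Fin (2 ^ N - 1)} (h : (j, j') ∈ (A.transpose.mul A).val.pat) : j = j' := by
  obtain ⟨c, h1, h2⟩ := mem_pat_mul.1 h
  have := (hA c j (mem_pat_transpose.1 h1)).eq_of_eq ht0 (hA c j' h2)
  exact Fin.ext (by omega)

theorem IsTouching.card_products_le {A : BlockSparse (2 ^ N - 1) k} (hA : A.IsTouching t)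
    (ht0 : 0 < t) : (products A.transpose A).card ≤ 2 ^ N := by
  refine card_le_of_injOn_fin (fun x => x.2) ?_
  rintro ⟨⟨j, j'⟩, c⟩ hx ⟨⟨i, i'⟩, c'⟩ hx' (rfl : c = c')
  obtain ⟨h1, h2⟩ := mem_products.1 hx
  obtain ⟨h3, h4⟩ := mem_products.1 hx'
  have e : ∀ a b, (c, a) ∈ A.pat → (c, b) ∈ A.pat → a = b := fun a b ha hb => by
    have := (hA c a ha).eq_of_eq ht0 (hA c b hb)
    exact Fin.ext (by omega)
  rw [e j j' (mem_pat_transpose.1 h1) h2, e j' i h2 (mem_pat_transpose.1 h3),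
    e i i' (mem_pat_transpose.1 h3) h4]

/-- The pattern of the new columns of `P` in the rows of smaller levels. -/
def IsNewColumns (t : ℕ) (A : BlockSparse (2 ^ N - 1) k) : Prop :=
  ∀ i j, (i, j) ∈ A.pat → InSubtree t (i.val + 1) (j.val + 1) ∧ (i.val + 1) % 2 ^ t ≠ 0

theorem isNewColumns_mul {A : BlockSparse (2 ^ N - 1) k} (hA : A.IsTouching t) (ht0 : 0 < t)
    (hP : P.IsDyadicBelow t) : (P.mul A).val.IsNewColumns t := by
  intro i j h
  obtain ⟨c, hic, hcj⟩ := mem_pat_mul.1 h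
  obtain ⟨s, hs, h⟩ := hP i c hic
  have hT := hA c j hcj
  refine ⟨⟨hT.1, ?_, mod_two_pow_ne_zero_of_le (by omega) h.2.2⟩,
    mod_two_pow_ne_zero_of_le hs h.2.2⟩
  rw [← hT.div_eq ht0]
  exact div_two_pow_eq_of_le (by omega) h.2.1

theorem IsNewColumns.mul_diagonal {A G : BlockSparse (2 ^ N - 1) k} (hA : A.IsNewColumns t)
    (hG : ∀ i j, (i, j) ∈ G.pat → i = j) : (A.mul G).val.IsNewColumns t := by
  intro i j h
  obtain ⟨c, hic, hcj⟩ := mem_pat_mul.1 h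
  exact hG c j hcj ▸ hA i c hic

theorem IsNewColumns.right_unique {A : BlockSparse (2 ^ N - 1) k} (hA : A.IsNewColumns t)
    {i j j' : Fin (2 ^ N - 1)} (h : (i, j) ∈ A.pat) (h' : (i, j') ∈ A.pat) : j = j' := by
  have := (hA i j h).1.eq_of_eq (hA i j' h').1
  exact Fin.ext (by omega)

theorem IsNewColumns.card_pat_le {A : BlockSparse (2 ^ N - 1) k} (hA : A.IsNewColumns t) :
    A.pat.card ≤ 2 ^ N := by
  refine card_le_of_injOn_fin (fun x => x.1) ?_
  rintro ⟨i, j⟩ hx ⟨i', j'⟩ hx' (rfl : i = i')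
  rw [hA.right_unique hx hx']

theorem IsNewColumns.card_products_le {A G : BlockSparse (2 ^ N - 1) k} (hA : A.IsNewColumns t)
    (hG : ∀ i j, (i, j) ∈ G.pat → i = j) : (products A G).card ≤ 2 ^ N := by
  refine card_le_of_injOn_fin (fun x => x.1.1) ?_
  rintro ⟨⟨i, j⟩, c⟩ hx ⟨⟨i', j'⟩, c'⟩ hx' (rfl : i = i')
  obtain ⟨h1, h2⟩ := mem_products.1 hx
  obtain ⟨h3, h4⟩ := mem_products.1 hx'
  have h5 := hG _ _ h2
  have h6 := hG _ _ h4
  have h7 := hA.right_unique h1 h3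
  simp only at h5 h6 h7
  rw [← h5, ← h6, h7]

end Patterns

end BlockSparse

/-! ### The passage from one level to the next -/

namespace BlockSparse

open Matrix

/-- One step of the algorithm: `P` orthogonalizes the part of `S` with indices in `U`, and it is
extended by columns with indices in `L`. -/
noncomputable def levelStep {n k : ℕ} (U L : Finset (Fin n)) (S P : BlockSparse n k) :
    Flop (BlockSparse n k) := do
  let S₁ := S.restrict U L
  let S₂ ← P.transpose.mul S₁
  let A ← P.mul S₂
  let B ← S₂.transpose.mul S₂
  let S₃ ← (S.restrict L L).sub B
  let G ← orthDiag L S₃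
  let AG ← A.mul G
  let negAG ← empty.sub AG
  return (P.merge negAG).merge G

theorem levelStep_gramian {n k : ℕ} {U L : Finset (Fin n)} {S P : BlockSparse n k}
    (hS : S.toMatrix.PosDef) (hUL : Disjoint U L) (hPl : ∀ i j, (i, j) ∈ P.pat → i ∈ U)
    (hPr : ∀ i j, (i, j) ∈ P.pat → j ∈ U)
    (hP : P.toMatrixᵀ * S.toMatrix * P.toMatrix = blockProj k U)
    (hSL : ∀ i j, (i, j) ∈ (S.restrict L L).pat → i = j)
    (hB : ∀ i j, (i, j) ∈ ((P.transpose.mul (S.restrict U L)).val.transpose.mul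
      (P.transpose.mul (S.restrict U L)).val).val.pat → i = j) :
    (levelStep U L S P).val.toMatrixᵀ * S.toMatrix * (levelStep U L S P).val.toMatrix =
      blockProj k (U ∪ L) := by
  set S₂ := (P.transpose.mul (S.restrict U L)).val with hS₂
  set A := (P.mul S₂).val with hA
  set S₃ := ((S.restrict L L).sub (S₂.transpose.mul S₂).val).val with hS₃
  set G := (orthDiag L S₃).val with hG
  set AG := (A.mul G).val with hAG
  have hval : (levelStep U L S P).val = (P.merge (empty.sub AG).val).merge G := rfl
  have hSt : S.toMatrixᵀ = S.toMatrix := by simpa using hS.isHermitian.eq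
  have hEP : blockProj k U * P.toMatrix = P.toMatrix := blockProj_mul_toMatrix hPl
  have hPE : P.toMatrix * blockProj k U = P.toMatrix := toMatrix_mul_blockProj hPr
  have hFP : blockProj k L * P.toMatrix = 0 := by
    rw [← hEP, ← Matrix.mul_assoc, blockProj_mul_blockProj_of_disjoint hUL.symm, Matrix.zero_mul]
  have hPtE : P.toMatrixᵀ * blockProj k U = P.toMatrixᵀ := by
    have := congrArg Matrix.transpose hEP
    rwa [transpose_mul, transpose_blockProj] at this
  have hmS₂ : S₂.toMatrix = P.toMatrixᵀ * S.toMatrix * blockProj k L := by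
    rw [hS₂, toMatrix_mul, toMatrix_transpose, toMatrix_restrict, ← Matrix.mul_assoc,
      ← Matrix.mul_assoc, hPtE]
  have hmS₃ : S₃.toMatrix = blockProj k L * S.toMatrix * blockProj k L -
      (P.toMatrixᵀ * S.toMatrix * blockProj k L)ᵀ *
        (P.toMatrixᵀ * S.toMatrix * blockProj k L) := by
    rw [hS₃, toMatrix_sub, toMatrix_restrict, toMatrix_mul, toMatrix_transpose, hmS₂]
  have hS₃diag : ∀ i j, (i, j) ∈ S₃.pat → i = j := by
    intro i j h
    rw [hS₃, pat_sub, Finset.mem_union] at h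
    exact h.elim (hSL i j) (hB i j)
  have hpos : ∀ i ∈ L, (S₃.get i i).PosDef := by
    intro i hi
    refine posDef_get_of_toMatrix_eq hS
      (W := blockProj k L - P.toMatrix * (P.toMatrixᵀ * S.toMatrix * blockProj k L)) ?_ ?_ hi
    · rw [Matrix.mul_sub, ← Matrix.mul_assoc (blockProj k L) P.toMatrix, hFP, Matrix.zero_mul,
        sub_zero, blockProj_mul_blockProj]
    · rw [hmS₃, residual_gramian hSt (transpose_blockProj L) (transpose_blockProj U) hPE hP]
  have hGS : G.toMatrixᵀ * S₃.toMatrix * G.toMatrix = blockProj k L :=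
    orthDiag_transpose_mul_mul hS₃diag hpos
  have hFG : blockProj k L * G.toMatrix = G.toMatrix :=
    blockProj_mul_toMatrix fun i j h => (mem_pat_orthDiag.1 h).1
  have hAGpat : ∀ i j, (i, j) ∈ AG.pat → i ∈ U ∧ j ∈ L := by
    intro i j h
    obtain ⟨m, hm, hmj⟩ := mem_pat_mul.1 h
    obtain ⟨m', hm', -⟩ := mem_pat_mul.1 hm
    obtain ⟨hmL, rfl⟩ := mem_pat_orthDiag.1 hmj
    exact ⟨hPl i m' hm', hmL⟩
  have hneg : ∀ i j, (i, j) ∈ (empty.sub AG).val.pat → (i, j) ∈ AG.pat := by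
    intro i j h
    rw [pat_sub] at h
    simpa [empty] using h
  have hd1 : Disjoint P.pat (empty.sub AG).val.pat :=
    Finset.disjoint_left.2 fun ⟨i, j⟩ h h' =>
      Finset.disjoint_left.1 hUL (hPr i j h) (hAGpat i j (hneg i j h')).2
  have hd2 : Disjoint (P.merge (empty.sub AG).val).pat G.pat := by
    refine Finset.disjoint_left.2 fun ⟨i, j⟩ h h' => ?_
    refine Finset.disjoint_left.1 hUL ?_ (mem_pat_orthDiag.1 h').1
    rcases Finset.mem_union.1 h with h | h
    · exact hPl i j h
    · exact (hAGpat i j (hneg i j h)).1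
  rw [hval, toMatrix_merge hd2, toMatrix_merge hd1, toMatrix_sub, toMatrix_empty, hAG,
    toMatrix_mul, hA, toMatrix_mul, hmS₂, blockProj_union hUL]
  refine extended_gramian hSt (transpose_blockProj L) (transpose_blockProj U) hPE hP hFG ?_
  rw [← hmS₃, hGS]

section DyadicStep

variable {N k t : ℕ} {P S : BlockSparse (2 ^ N - 1) k}

theorem isDyadicBelow_levelStep (hS : S.pat ⊆ tridiagonal (2 ^ N - 1)) (ht0 : 0 < t) (ht : t < N)
    (hP : P.IsDyadicBelow t) :
    (levelStep (levelsBelow N (t + 1)) (level N (t + 1)) S P).val.IsDyadicBelow (t + 1) := by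
  intro i j h
  have hA := isNewColumns_mul (isTouching_mul hS ht hP) ht0 hP
  simp only [levelStep, Flop.val_bind, Flop.val_pure, merge, Finset.mem_union, pat_sub] at h
  rcases h with (h | h | h) | h
  · obtain ⟨s, hs, h⟩ := hP i j h
    exact ⟨s, by omega, h⟩
  · simp [empty] at h
  · exact ⟨t, by omega, (hA.mul_diagonal (fun i j h => (mem_pat_orthDiag.1 h).2) i j h).1⟩
  · obtain ⟨hi, rfl⟩ := mem_pat_orthDiag.1 h
    exact ⟨t, by omega, .self ((mem_level ht).1 hi)⟩

theorem cost_levelStep_le (hk : 1 ≤ k) (hS : S.pat ⊆ tridiagonal (2 ^ N - 1)) (ht0 : 0 < t)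
    (ht : t < N) (hP : P.IsDyadicBelow t) :
    (levelStep (levelsBelow N (t + 1)) (level N (t + 1)) S P).cost ≤ 23 * 2 ^ N * k ^ 3 := by
  have hS₂ := isTouching_mul hS ht hP
  have c1 := card_products_transpose_mul_le hS ht0 ht hP
  have m1 := cost_mul_le P.transpose (S.restrict (levelsBelow N (t + 1)) (level N (t + 1)))
  set S₂ := (P.transpose.mul (S.restrict (levelsBelow N (t + 1)) (level N (t + 1)))).val with eS₂
  have c2 := card_products_mul_isTouching_le hS₂ ht hP
  have m2 := cost_mul_le P S₂
  have hA := isNewColumns_mul hS₂ ht0 hP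
  set A := (P.mul S₂).val with eA
  have c3 := hS₂.card_products_le ht0
  have m3 := cost_mul_le S₂.transpose S₂
  have hB : (S₂.transpose.mul S₂).val.pat.card ≤ 2 ^ N := by
    refine card_le_of_injOn_fin (fun x => x.1) ?_
    rintro ⟨i, j⟩ hx ⟨i', j'⟩ hx' (rfl : i = i')
    rw [← hS₂.diagonal ht0 hx, ← hS₂.diagonal ht0 hx']
  set B := (S₂.transpose.mul S₂).val with eB
  have m4 := cost_sub (S.restrict (level N (t + 1)) (level N (t + 1))) B
  set S₃ := ((S.restrict (level N (t + 1)) (level N (t + 1))).sub B).val with eS₃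
  have c5 : (level N (t + 1)).card ≤ 2 ^ N := card_le_of_injOn_fin id (Set.injOn_id _)
  have m5 := cost_orthDiag_le (level N (t + 1)) S₃
  have hG : ∀ i j, (i, j) ∈ (orthDiag (level N (t + 1)) S₃).val.pat → i = j :=
    fun i j h => (mem_pat_orthDiag.1 h).2
  set G := (orthDiag (level N (t + 1)) S₃).val with eG
  have c6 := hA.card_products_le hG
  have m6 := cost_mul_le A G
  have c7 := (hA.mul_diagonal hG).card_pat_le
  have m7 := cost_sub empty (A.mul G).val
  have hcost : (levelStep (levelsBelow N (t + 1)) (level N (t + 1)) S P).cost =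
      (P.transpose.mul (S.restrict (levelsBelow N (t + 1)) (level N (t + 1)))).cost +
      ((P.mul S₂).cost + ((S₂.transpose.mul S₂).cost +
      (((S.restrict (level N (t + 1)) (level N (t + 1))).sub B).cost +
      ((orthDiag (level N (t + 1)) S₃).cost + ((A.mul G).cost +
      ((empty.sub (A.mul G).val).cost + 0)))))) := rfl
  have hk3 : k ^ 2 ≤ k ^ 3 := Nat.pow_le_pow_right hk (by omega)
  rw [hcost]
  have q1 := m1.trans (Nat.mul_le_mul_right (2 * k ^ 3) c1)
  have q2 := m2.trans (Nat.mul_le_mul_right (2 * k ^ 3) c2)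
  have q3 := m3.trans (Nat.mul_le_mul_right (2 * k ^ 3) c3)
  have q4 := m4.le.trans (Nat.mul_le_mul hB hk3)
  have q5 := m5.trans (Nat.mul_le_mul_right (11 * k ^ 3) c5)
  have q6 := m6.trans (Nat.mul_le_mul_right (2 * k ^ 3) c6)
  have q7 := m7.le.trans (Nat.mul_le_mul c7 hk3)
  refine (Nat.add_le_add q1 (Nat.add_le_add q2 (Nat.add_le_add q3 (Nat.add_le_add q4
    (Nat.add_le_add q5 (Nat.add_le_add q6 (Nat.add_le_add q7 le_rfl))))))).trans_eq ?_
  ring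

/-- The state after the levels `1, …, t + 1`: its pattern, its gramian, and the flops spent. -/
theorem sequentialOrth_spec (hk : 1 ≤ k) (hS : S.pat ⊆ tridiagonal (2 ^ N - 1))
    (hpos : S.toMatrix.PosDef) (ht : t < N) :
    (sequentialOrth N S (t + 1)).val.IsDyadicBelow (t + 1) ∧
    (sequentialOrth N S (t + 1)).val.toMatrixᵀ * S.toMatrix *
      (sequentialOrth N S (t + 1)).val.toMatrix = blockProj k (levelsBelow N (t + 2)) ∧
    (sequentialOrth N S (t + 1)).cost ≤ (t + 1) * (23 * 2 ^ N * k ^ 3) := by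
  induction t with
  | zero =>
    have hdiag : ∀ i j, (i, j) ∈ (S.restrict (level N 1) (level N 1)).pat → i = j :=
      fun i j h => diagonal_of_mem_pat_restrict_level hS ht h
    have hF := transpose_blockProj (k := k) (level N 1)
    refine ⟨?_, ?_, ?_⟩
    · intro i j h
      obtain ⟨hi, rfl⟩ := mem_pat_orthDiag.1 h
      exact ⟨0, one_pos, .self ((mem_level ht).1 hi)⟩
    · set G := (sequentialOrth N S (0 + 1)).val with hG
      have hFG : blockProj k (level N 1) * G.toMatrix = G.toMatrix :=
        blockProj_mul_toMatrix fun i j h => (mem_pat_orthDiag.1 h).1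
      have hGF : G.toMatrixᵀ * blockProj k (level N 1) = G.toMatrixᵀ := by
        have := congrArg Matrix.transpose hFG
        rwa [transpose_mul, hF] at this
      have hpd : ∀ i ∈ level N 1,
          ((S.restrict (level N 1) (level N 1)).get i i).PosDef := fun i hi =>
        posDef_get_of_toMatrix_eq hpos (W := blockProj k (level N 1))
          (blockProj_mul_blockProj _) (by rw [hF, toMatrix_restrict]) hi
      have h : G.toMatrixᵀ * (S.restrict (level N 1) (level N 1)).toMatrix * G.toMatrix =
          blockProj k (level N 1) := orthDiag_transpose_mul_mul hdiag hpd
      rw [levelsBelow_succ, levelsBelow_one, Finset.empty_union, zero_add, ← h, toMatrix_restrict]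
      calc G.toMatrixᵀ * S.toMatrix * G.toMatrix
          = (G.toMatrixᵀ * blockProj k (level N 1)) * S.toMatrix *
              (blockProj k (level N 1) * G.toMatrix) := by rw [hGF, hFG]
        _ = _ := by simp only [Matrix.mul_assoc]
    · have h : (sequentialOrth N S (0 + 1)).cost ≤ (level N 1).card * (11 * k ^ 3) :=
        cost_orthDiag_le _ _
      have hc : (level N 1).card ≤ 2 ^ N := card_le_of_injOn_fin id (Set.injOn_id _)
      have h' := Nat.mul_le_mul_right (11 * k ^ 3) hc
      have h0 : 0 ≤ 2 ^ N * k ^ 3 := Nat.zero_le _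
      linarith
  | succ t ih =>
    obtain ⟨hP, hgram, hcost⟩ := ih (by omega)
    have hrec : sequentialOrth N S (t + 1 + 1) = sequentialOrth N S (t + 1) >>=
        levelStep (levelsBelow N (t + 1 + 1)) (level N (t + 1 + 1)) S := rfl
    refine ⟨?_, ?_, ?_⟩
    · rw [hrec, Flop.val_bind]
      exact isDyadicBelow_levelStep hS t.succ_pos ht hP
    · rw [hrec, Flop.val_bind, levelsBelow_succ N (t + 1)]
      exact levelStep_gramian hpos (disjoint_levelsBelow_level ht)
        (fun i j h => hP.mem_levelsBelow_left ht.le h)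
        (fun i j h => hP.mem_levelsBelow_right ht.le h) hgram
        (fun i j h => diagonal_of_mem_pat_restrict_level hS ht h)
        (fun i j h => (isTouching_mul hS ht hP).diagonal t.succ_pos h)
    · rw [hrec, Flop.cost_bind]
      have h := cost_levelStep_le hk hS t.succ_pos ht hP
      calc _ ≤ (t + 1) * (23 * 2 ^ N * k ^ 3) + 23 * 2 ^ N * k ^ 3 := Nat.add_le_add hcost h
        _ = _ := by ring

end DyadicStep

end BlockSparse

/-! ### The flop bound in terms of the dimension -/

/-- `N` levels with `O(2 ^ N k³)` flops each amount to `O(d k² log (d / k))` flops. -/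
theorem levels_mul_two_pow_le {N k : ℕ} (hN : 2 ≤ N) (hk : 1 ≤ k) :
    (N : ℝ) * (2 ^ N * (k : ℝ) ^ 3) ≤
      8 * (((k * (2 ^ N - 1) : ℕ) : ℝ) * (k : ℝ) ^ 2 *
        Real.log (((k * (2 ^ N - 1) : ℕ) : ℝ) / (k : ℝ))) := by
  have hk0 : (k : ℝ) ≠ 0 := by positivity
  obtain ⟨M, rfl⟩ := Nat.exists_eq_add_of_le' hN
  have hpow : (1 : ℝ) ≤ 2 ^ (M + 1) := one_le_pow₀ (by norm_num)
  have hcast : ((2 ^ (M + 2) - 1 : ℕ) : ℝ) = 2 ^ (M + 2) - 1 := by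
    rw [Nat.cast_sub Nat.one_le_two_pow]
    simp
  have hlow : (2 : ℝ) ^ (M + 1) ≤ 2 ^ (M + 2) - 1 := by
    rw [pow_succ _ (M + 1)]
    linarith
  have hlog : ((M : ℝ) + 2) / 4 ≤ Real.log (2 ^ (M + 2) - 1) := by
    calc ((M : ℝ) + 2) / 4 ≤ (M + 1 : ℕ) * Real.log 2 := by
          have := Real.log_two_gt_d9
          push_cast
          nlinarith [(Nat.cast_nonneg M : (0 : ℝ) ≤ M)]
      _ = Real.log (2 ^ (M + 1)) := (Real.log_pow _ _).symm
      _ ≤ _ := Real.log_le_log (by positivity) hlow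
  rw [Nat.cast_mul, hcast, mul_div_cancel_left₀ _ hk0]
  have hM : (0 : ℝ) ≤ ((M : ℝ) + 2) / 4 := by positivity
  calc ((M + 2 : ℕ) : ℝ) * (2 ^ (M + 2) * (k : ℝ) ^ 3)
      = 8 * ((k : ℝ) ^ 3 * (2 ^ (M + 1) * (((M : ℝ) + 2) / 4))) := by push_cast; ring
    _ ≤ 8 * ((k : ℝ) ^ 3 * ((2 ^ (M + 2) - 1) * Real.log (2 ^ (M + 2) - 1))) := by
        have hd : (0 : ℝ) ≤ 2 ^ (M + 2) - 1 := by linarith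
        gcongr
    _ = _ := by ring

end Dyadic

theorem theorem3p9 :
    ∃ C : ℝ, 0 < C ∧ ∀ (N k d : ℕ), 1 ≤ N → 1 ≤ k → d = k * (2 ^ N - 1) →
      ∀ S : Matrix (Fin (2 ^ N - 1) × Fin k) (Fin (2 ^ N - 1) × Fin k) ℝ,
        S.PosDef → Dyadic.HasPattern (Dyadic.tridiagonal (2 ^ N - 1)) S →
        ∀ (P : Matrix (Fin (2 ^ N - 1) × Fin k) (Fin (2 ^ N - 1) × Fin k) ℝ) (flops : ℕ),
          P = (Dyadic.dyadicAlgorithm N (Dyadic.tridiagonal (2 ^ N - 1)) S).val.toMatrix →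
          flops = (Dyadic.dyadicAlgorithm N (Dyadic.tridiagonal (2 ^ N - 1)) S).cost →
          Dyadic.HasPattern (Dyadic.verticallyDyadic N) P ∧
          P.transpose * S * P = 1 ∧
          (2 ≤ N → (flops : ℝ) ≤ C * ((d : ℝ) * (k : ℝ) ^ 2 * Real.log ((d : ℝ) / (k : ℝ)))) ∧
          (N = 1 → (flops : ℝ) ≤ C * ((d : ℝ) * (k : ℝ) ^ 2)) := by
  refine ⟨184, by norm_num, ?_⟩
  rintro N k d hN hk rfl S hS hpat P flops rfl rfl
  obtain ⟨t, rfl⟩ := Nat.exists_eq_add_of_le' hN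
  have hmat := Dyadic.BlockSparse.toMatrix_ofMatrix hpat
  obtain ⟨h1, h2, h3⟩ := Dyadic.BlockSparse.sequentialOrth_spec (t := t) (N := t + 1)
    (S := Dyadic.BlockSparse.ofMatrix (Dyadic.tridiagonal (2 ^ (t + 1) - 1)) S) hk
    (Finset.Subset.refl _) (hmat.symm ▸ hS) t.lt_succ_self
  have hcost : ((Dyadic.dyadicAlgorithm (t + 1) (Dyadic.tridiagonal (2 ^ (t + 1) - 1)) S).cost : ℝ)
      ≤ 23 * (((t + 1 : ℕ) : ℝ) * (2 ^ (t + 1) * (k : ℝ) ^ 3)) := by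
    calc _ ≤ (((t + 1) * (23 * 2 ^ (t + 1) * k ^ 3) : ℕ) : ℝ) := Nat.cast_le.2 h3
      _ = _ := by push_cast; ring
  refine ⟨?_, ?_, ?_, ?_⟩
  · refine Dyadic.BlockSparse.hasPattern_toMatrix fun ⟨i, j⟩ h => ?_
    obtain ⟨s, hs, h⟩ := h1 i j h
    exact Dyadic.mem_verticallyDyadic hs h
  · rw [hmat, Dyadic.levelsBelow_eq_univ, Dyadic.BlockSparse.blockProj_univ] at h2
    exact h2
  · intro h
    have := Dyadic.levels_mul_two_pow_le h hk
    linarith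
  · intro h
    obtain rfl : t = 0 := by omega
    refine hcost.trans ?_
    have hk3 : (0 : ℝ) ≤ (k : ℝ) ^ 3 := by positivity
    norm_num
    nlinarith
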